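/- All graphs are finite, simple and undirected. An automorphism group is semiregular on a set if all its point stabilisers are trivial, and regular if it is also transitive. A *bi-dihedrant* is a graph that admits a group of automorphisms isomorphic to the dihedral group of order $2n$, for some $n\ge 3$, acting semiregularly on the vertices with exactly two orbits. A graph $\Gamma$ is *edge-regular* if $\mathrm{Aut}(\Gamma)$ acts regularly on the edge set, and *semisymmetric* if all its vertices have the same valency and $\mathrm{Aut}(\Gamma)$ is transitive on the edges but not on the vertices. **Theorem 1.5.** Every connected semisymmetric bi-dihedrant has valency at least $6$. For every odd integer $k\ge 3$ there exists a connected semisymmetric bi-dihedrant of valency $2k$. Moreover, there is an infinite family of connected edge-regular semisymmetric bi-dihedrants of valency $6$: for every $N$ there is one with at least $N$ vertices. -/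

import Mathlib

namespace SimpleGraph

variable {V : Type*}

/-- Every vertex of `Γ` has exactly `d` neighbours: `Γ` has (constant) valency `d`. -/
def HasValency (Γ : SimpleGraph V) (d : ℕ) : Prop :=
  ∃ _ : Γ.LocallyFinite, Γ.IsRegularOfDegree d

/-- The full automorphism group `Γ ≃g Γ` is transitive on the vertices of `Γ`. -/
def IsVertexTransitive (Γ : SimpleGraph V) : Prop :=
  ∀ u v : V, ∃ f : Γ ≃g Γ, f u = v

/-- The full automorphism group is transitive on the edges (unordered pairs) of `Γ`. -/
def IsEdgeTransitive (Γ : SimpleGraph V) : Prop :=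
  ∀ e₁ e₂ : Γ.edgeSet, ∃ f : Γ ≃g Γ, f.mapEdgeSet e₁ = e₂

/-- The full automorphism group acts regularly on the edges of `Γ`: the action is transitive and
every edge has trivial (setwise) stabiliser. -/
def IsEdgeRegular (Γ : SimpleGraph V) : Prop :=
  Γ.IsEdgeTransitive ∧ ∀ (e : Γ.edgeSet) (f : Γ ≃g Γ), f.mapEdgeSet e = e → f = 1

/-- Constant valency, edge-transitive, not vertex-transitive. -/
def IsSemisymmetric (Γ : SimpleGraph V) : Prop :=
  (∃ d, Γ.HasValency d) ∧ Γ.IsEdgeTransitive ∧ ¬ Γ.IsVertexTransitive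

/-- `Γ` is a bi-Cayley graph over the group `H`: the group `H` acts on `Γ` by automorphisms
(through `φ`), semiregularly on the vertices, and with exactly two vertex orbits (those of `u`
and `w`). Semiregularity makes `φ` injective. -/
def IsBiCayleyOver (H : Type*) [Group H] (Γ : SimpleGraph V) : Prop :=
  ∃ φ : H →* (Γ ≃g Γ),
    (∀ (h : H) (v : V), φ h v = v → h = 1) ∧
    ∃ u w : V, (∀ h : H, φ h u ≠ w) ∧
      ∀ v : V, (∃ h : H, φ h u = v) ∨ (∃ h : H, φ h w = v)

/-- A bi-dihedrant is a bi-Cayley graph over a finite dihedral group of order `2 * n`, `n ≥ 3`. -/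
def IsBiDihedrant (Γ : SimpleGraph V) : Prop :=
  ∃ n : ℕ, 3 ≤ n ∧ Γ.IsBiCayleyOver (DihedralGroup n)

end SimpleGraph

/-!
A connected semisymmetric bi-Cayley graph over a dihedral group is bipartite, its halves being the
two orbits of the group, and is described by the set `S` of group elements `h` with `u` adjacent to
`h w`. If at most two rotations, or at most two reflections, lie in `S`, then some automorphism of
the dihedral group inverts the rotations and preserves the set of reflections in `S` (after moving `w` by a
reflection in the first case), and it induces an automorphism interchanging the halves. So a
semisymmetric example has at least three rotations and three reflections in `S`, which gives valency
at least six (`six_le_valency_of_isSemisymmetric`).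

All examples are instances of `signedGraph γ`. Its vertices are triples of two signs and an element
of an abelian group `A`. Each edge has a kind, one of two, and a label `γ c i` that depends on the
kind; it flips the sign of its kind and adds `±` its label, according to that sign. Translations
and negation of all coordinates form a generalized dihedral group with two regular orbits,
distinguished by the product of the signs, and automorphisms of `A` that permute the labels make
the graph edge-transitive.

For valency `2 k`, the group is a prime field and the labels are `± κ`, for `κ` in the subgroup of
order `k` of its units. Vertices with equal signs come in pairs with the same neighbours. Since `k`
is odd, the other vertices do not, and the graph is not vertex-transitive.

For valency six, `A` is `ZMod 7 × ZMod (m ^ 2 + m + 1)` and the labels are `(2 ^ i, ± m ^ i)`. For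
large `m` the second coordinate behaves like the Eisenstein integers in all short computations.
The 4-cycles then show that an automorphism respects or interchanges the kinds, and the hexagons
that it acts on the labels of each kind by one permutation for the whole graph
(`IsGenericLabel.exists_labelMap`). Such an automorphism maps closed walks to closed walks with
permuted labels. One closed walk, which reflects that `3 * 2 - 2 * 1 - 4 = 0`, forces it to preserve
the halves and to shift the labels of both kinds cyclically by the same amount
(`eisensteinLabel_rigid`). Hence the graph is semisymmetric and no nontrivial automorphism fixes an
edge.
-/

namespace SimpleGraph

/-! ### Bi-dihedrants of valency at most five -/

section SmallValency

/-- The automorphism of the dihedral group that inverts the rotations and reflects the index of the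
reflections in `t`. For odd `t` it need not be inner. -/
def dihedralFlip {n : ℕ} (t : ZMod n) : DihedralGroup n →* DihedralGroup n where
  toFun
    | .r i => .r (-i)
    | .sr j => .sr (t - j)
  map_one' := by
    change DihedralGroup.r (-0) = DihedralGroup.r 0
    simp
  map_mul' := by
    rintro (i | i) (j | j) <;> simp <;> abel

@[simp] lemma dihedralFlip_r {n : ℕ} (t i : ZMod n) :
    dihedralFlip t (.r i) = .r (-i) := rfl

@[simp] lemma dihedralFlip_sr {n : ℕ} (t j : ZMod n) :
    dihedralFlip t (.sr j) = .sr (t - j) := rfl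

lemma dihedralFlip_dihedralFlip {n : ℕ} (t : ZMod n) (h : DihedralGroup n) :
    dihedralFlip t (dihedralFlip t h) = h := by
  rcases h with i | i <;> simp

variable {V : Type*} {Γ : SimpleGraph V}

lemma adj_iso_iff {H : Type*} [Group H] (φ : H →* (Γ ≃g Γ)) (g h : H) (u w : V) :
    Γ.Adj (φ g u) (φ h w) ↔ Γ.Adj u (φ (g⁻¹ * h) w) := by
  rw [← (φ g).map_adj_iff (v := u) (w := φ (g⁻¹ * h) w), ← RelIso.mul_apply, ← map_mul]
  simp

/-- A bipartite bi-Cayley graph over a group `H` with an involutory automorphism `α` that maps the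
connection set to its inverse has an automorphism interchanging the two orbits of `H`. -/
lemma exists_swap_of_involution {H : Type*} [Group H] (φ : H →* (Γ ≃g Γ))
    (hφ : ∀ (h : H) (v : V), φ h v = v → h = 1) {u w : V} (huw : ∀ h : H, φ h u ≠ w)
    (hcov : ∀ v : V, (∃ h : H, φ h u = v) ∨ (∃ h : H, φ h w = v))
    (hu : ∀ h : H, ¬ Γ.Adj u (φ h u)) (hw : ∀ h : H, ¬ Γ.Adj w (φ h w))
    (α : H →* H) (hα : ∀ h, α (α h) = h)
    (hS : ∀ h, Γ.Adj u (φ h w) → Γ.Adj u (φ (α h⁻¹) w)) :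
    ∃ f : Γ ≃g Γ, f u = w := by
  have hinj : ∀ v (g h : H), φ g v = φ h v → g = h := by
    intro v g h e
    have : φ (h⁻¹ * g) v = v := by
      rw [map_mul, RelIso.mul_apply, e, ← RelIso.mul_apply, ← map_mul]; simp
    exact (inv_mul_eq_one.mp (hφ _ _ this)).symm
  have hne : ∀ g h : H, φ g u ≠ φ h w := by
    intro g h e
    apply huw (h⁻¹ * g)
    rw [map_mul, RelIso.mul_apply, e, ← RelIso.mul_apply, ← map_mul]; simp
  let e : H ⊕ H ≃ V := Equiv.ofBijective (Sum.elim (fun h => φ h u) (fun h => φ h w)) (by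
    constructor
    · rintro (g | g) (h | h) e
      · exact congrArg _ (hinj _ _ _ e)
      · exact absurd e (hne _ _)
      · exact absurd e.symm (hne _ _)
      · exact congrArg _ (hinj _ _ _ e)
    · intro v
      rcases hcov v with ⟨h, rfl⟩ | ⟨h, rfl⟩
      · exact ⟨.inl h, rfl⟩
      · exact ⟨.inr h, rfl⟩)
  have el : ∀ h, e (.inl h) = φ h u := fun h => rfl
  have er : ∀ h, e (.inr h) = φ h w := fun h => rfl
  let σ : H ⊕ H → H ⊕ H := Sum.elim (fun h => .inr (α h)) (fun h => .inl (α h))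
  have hσ : Function.Involutive σ := by rintro (h | h) <;> simp [σ, hα]
  have hadj : ∀ a b, Γ.Adj (e a) (e b) → Γ.Adj (e (σ a)) (e (σ b)) := by
    rintro (g | g) (h | h)
    · simp only [el]
      rw [adj_iso_iff]
      exact fun H => absurd H (hu _)
    · simp only [σ, Sum.elim_inl, Sum.elim_inr, el, er]
      intro H
      rw [adj_iso_iff] at H
      rw [adj_comm, adj_iso_iff]
      simpa using hS _ H
    · simp only [σ, Sum.elim_inl, Sum.elim_inr, el, er]
      intro H
      rw [adj_comm, adj_iso_iff] at H
      rw [adj_iso_iff]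
      simpa using hS _ H
    · simp only [er]
      rw [adj_iso_iff]
      exact fun H => absurd H (hw _)
  let F : V ≃ V := e.symm.trans (hσ.toPerm.trans e)
  have hF : ∀ a, F (e a) = e (σ a) := by intro a; simp [F]
  refine ⟨⟨F, ?_⟩, ?_⟩
  · intro a b
    obtain ⟨a, rfl⟩ := e.surjective a
    obtain ⟨b, rfl⟩ := e.surjective b
    rw [hF, hF]
    refine ⟨fun H => ?_, hadj a b⟩
    simpa only [hσ a, hσ b] using hadj _ _ H
  · have h1 : u = e (.inl 1) := by simp [el]
    change F u = w
    rw [h1, hF]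
    simp [σ, er]

/-- A set of at most two elements of an abelian group is symmetric about some point. -/
lemma exists_reflection_of_ncard_le_two {A : Type*} [AddCommGroup A] {J : Set A} (hJ : J.Finite)
    (h : J.ncard ≤ 2) : ∃ t, ∀ j ∈ J, t - j ∈ J := by
  interval_cases hc : J.ncard
  · exact ⟨0, fun j hj => by simp [(Set.ncard_eq_zero hJ).mp hc] at hj⟩
  · obtain ⟨a, rfl⟩ := Set.ncard_eq_one.mp hc
    exact ⟨a + a, fun j hj => by simp_all⟩
  · obtain ⟨a, b, -, rfl⟩ := Set.ncard_eq_two.mp hc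
    refine ⟨a + b, fun j hj => ?_⟩
    rcases hj with rfl | rfl <;> simp

lemma exists_swap_of_reflections {n : ℕ} [NeZero n] (φ : DihedralGroup n →* (Γ ≃g Γ))
    (hφ : ∀ (h : DihedralGroup n) (v : V), φ h v = v → h = 1) {u w : V}
    (huw : ∀ h, φ h u ≠ w) (hcov : ∀ v : V, (∃ h, φ h u = v) ∨ (∃ h, φ h w = v))
    (hu : ∀ h, ¬ Γ.Adj u (φ h u)) (hw : ∀ h, ¬ Γ.Adj w (φ h w))
    (hJ : {j : ZMod n | Γ.Adj u (φ (.sr j) w)}.ncard ≤ 2) :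
    ∃ f : Γ ≃g Γ, f u = w := by
  obtain ⟨t, ht⟩ := exists_reflection_of_ncard_le_two (Set.toFinite _) hJ
  refine exists_swap_of_involution φ hφ huw hcov hu hw (dihedralFlip t)
    (dihedralFlip_dihedralFlip t) ?_
  rintro (i | j) h
  · simpa using h
  · simpa using ht j h

theorem six_le_valency_of_isSemisymmetric [Finite V] (hconn : Γ.Connected)
    (hbd : Γ.IsBiDihedrant) (hss : Γ.IsSemisymmetric) {d : ℕ} (hd : Γ.HasValency d) : 6 ≤ d := by
  obtain ⟨n, hn, φ, hφ, u, w, huw, hcov⟩ := hbd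
  obtain ⟨-, het, hvt⟩ := hss
  have : NeZero n := ⟨by omega⟩
  -- an automorphism moving a vertex of one orbit of `φ` to the other makes `Γ` vertex-transitive
  have key : ∀ (f : Γ ≃g Γ) (g h : DihedralGroup n), f (φ g u) ≠ φ h w := by
    intro f g h e
    apply hvt
    have hu : ∀ v, ∃ k : Γ ≃g Γ, k u = v := by
      intro v
      rcases hcov v with ⟨a, rfl⟩ | ⟨a, rfl⟩
      · exact ⟨φ a, rfl⟩
      · refine ⟨φ a * (φ h)⁻¹ * f * φ g, ?_⟩
        simp only [RelIso.mul_apply, e]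
        rw [← RelIso.mul_apply (φ h)⁻¹, inv_mul_cancel]; rfl
    intro a b
    obtain ⟨k, rfl⟩ := hu a
    obtain ⟨l, rfl⟩ := hu b
    refine ⟨l * k⁻¹, ?_⟩
    rw [RelIso.mul_apply, ← RelIso.mul_apply k⁻¹, inv_mul_cancel]; rfl
  have key' : ∀ (f : Γ ≃g Γ) (g h : DihedralGroup n), f (φ h w) ≠ φ g u := by
    intro f g h e
    apply key f⁻¹ g h
    rw [← e, ← RelIso.mul_apply, inv_mul_cancel]; rfl
  -- some edge joins the two orbits, hence all edges do
  obtain ⟨x, y, hxy, ⟨a, rfl⟩, hy⟩ : ∃ x y, Γ.Adj x y ∧ (∃ h, φ h u = x) ∧ ¬ ∃ h, φ h u = y := by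
    by_contra! hcon
    have : ∀ v, Γ.Reachable u v → ∃ h, φ h u = v := by
      intro v hv
      rw [reachable_iff_reflTransGen] at hv
      induction hv with
      | refl => exact ⟨1, by simp⟩
      | tail _ hbc ih => exact hcon _ _ hbc ih
    obtain ⟨h, hh⟩ := this w (hconn.preconnected u w)
    exact huw h hh
  obtain ⟨b, rfl⟩ := (hcov y).resolve_left hy
  have hedge : ∀ v v', Γ.Adj v v' → ∃ f : Γ ≃g Γ, s(f (φ a u), f (φ b w)) = s(v, v') := by
    intro v v' h
    obtain ⟨f, hf⟩ := het ⟨s(φ a u, φ b w), hxy⟩ ⟨s(v, v'), h⟩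
    exact ⟨f, by simpa using congrArg Subtype.val hf⟩
  have hu : ∀ h, ¬ Γ.Adj u (φ h u) := by
    intro h hadj
    obtain ⟨f, hf⟩ := hedge _ _ hadj
    rcases Sym2.eq_iff.mp hf with ⟨-, h2⟩ | ⟨-, h2⟩
    · exact key' f _ _ h2
    · exact key' f 1 _ (by simpa using h2)
  have hw : ∀ h, ¬ Γ.Adj w (φ h w) := by
    intro h hadj
    obtain ⟨f, hf⟩ := hedge _ _ hadj
    rcases Sym2.eq_iff.mp hf with ⟨h1, -⟩ | ⟨h1, -⟩
    · exact key f _ 1 (by simpa using h1)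
    · exact key f _ _ h1
  by_contra! hlt
  set I : Set (ZMod n) := {i | Γ.Adj u (φ (.r i) w)} with hI
  set J : Set (ZMod n) := {j | Γ.Adj u (φ (.sr j) w)} with hJ
  have hinj : Function.Injective fun h => φ h w := by
    intro g h e
    have : φ (h⁻¹ * g) w = w := by
      rw [map_mul, RelIso.mul_apply, show φ g w = φ h w from e, ← RelIso.mul_apply, ← map_mul]
      simp
    exact (inv_mul_eq_one.mp (hφ _ _ this)).symm
  have hcard : I.ncard + J.ncard ≤ d := by
    obtain ⟨lf, hreg⟩ := hd
    have h1 : (Γ.neighborSet u).ncard = d := by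
      rw [← hreg u, ← card_neighborSet_eq_degree, Set.ncard_eq_toFinset_card',
        Set.toFinset_card]
    rw [← h1, ← Set.ncard_image_of_injective I (f := fun i => φ (.r i) w)
        (fun i j e => by simpa using hinj e),
      ← Set.ncard_image_of_injective J (f := fun i => φ (.sr i) w)
        (fun i j e => by simpa using hinj e),
      ← Set.ncard_union_eq ?_ (Set.toFinite _) (Set.toFinite _)]
    · refine Set.ncard_le_ncard ?_ (Set.toFinite _)
      rintro v (⟨i, hi, rfl⟩ | ⟨i, hi, rfl⟩) <;> exact hi
    · rw [Set.disjoint_left]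
      rintro _ ⟨i, -, rfl⟩ ⟨j, -, e⟩
      simpa using hinj e
  rcases le_or_gt J.ncard 2 with h2 | h2
  · obtain ⟨f, hf⟩ := exists_swap_of_reflections φ hφ huw hcov hu hw h2
    exact key f 1 1 (by simpa using hf)
  · -- moving the base point of the second orbit by a reflection exchanges `I` and `J`
    have hI2 : I.ncard ≤ 2 := by omega
    obtain ⟨f, hf⟩ := exists_swap_of_reflections φ hφ (u := u) (w := φ (.sr 0) w)
      (fun h e => key 1 h (.sr 0) e)
      (fun v => (hcov v).imp_right fun ⟨h, hh⟩ => ⟨h * .sr 0, by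
        rw [← RelIso.mul_apply, ← map_mul, mul_assoc]; simpa using hh⟩)
      hu (fun h => by
        rw [← RelIso.mul_apply, ← map_mul, adj_iso_iff]; exact hw _)
      (by
        rw [← Set.ncard_image_of_injective _ neg_injective]
        refine (Set.ncard_le_ncard ?_ (Set.toFinite _)).trans hI2
        rintro _ ⟨j, hj, rfl⟩
        rw [Set.mem_ofPred_eq, ← RelIso.mul_apply, ← map_mul] at hj
        simpa [hI] using hj)
    exact key f 1 (.sr 0) (by simpa using hf)

end SmallValency

/-! ### Twisted products of bi-Cayley graphs over an abelian group -/

section SignedGraph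

variable {A ι : Type*} [AddCommGroup A]

/-- The involution of `(Bool → ℤˣ) × A` that flips the sign of kind `c` and moves the group
coordinate by `γ c i`, in the direction given by the old sign. -/
def signedStep (γ : Bool → ι → A) (c : Bool) (i : ι) (x : (Bool → ℤˣ) × A) : (Bool → ℤˣ) × A :=
  (Function.update x.1 c (-x.1 c), x.2 + (x.1 c : ℤ) • γ c i)

variable {γ : Bool → ι → A}

@[simp] lemma signedStep_fst (c : Bool) (i : ι) (x : (Bool → ℤˣ) × A) :
    (signedStep γ c i x).1 = Function.update x.1 c (-x.1 c) := rfl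

@[simp] lemma signedStep_snd (c : Bool) (i : ι) (x : (Bool → ℤˣ) × A) :
    (signedStep γ c i x).2 = x.2 + (x.1 c : ℤ) • γ c i := rfl

@[simp] lemma signedStep_signedStep (c : Bool) (i : ι) (x : (Bool → ℤˣ) × A) :
    signedStep γ c i (signedStep γ c i x) = x := by
  ext <;> simp

lemma signedStep_pair (c : Bool) (i j : ι) (x : (Bool → ℤˣ) × A) :
    signedStep γ c j (signedStep γ c i x) = (x.1, x.2 + (x.1 c : ℤ) • (γ c i - γ c j)) := by
  ext
  · simp
  · simp [smul_sub]; abel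

lemma signedStep_comm {c d : Bool} (h : c ≠ d) (i j : ι) (x : (Bool → ℤˣ) × A) :
    signedStep γ c i (signedStep γ d j x) = signedStep γ d j (signedStep γ c i x) := by
  refine Prod.ext ?_ ?_
  · simp [Function.update_of_ne h, Function.update_of_ne h.symm, Function.update_comm h]
  · simp [Function.update_of_ne h, Function.update_of_ne h.symm]; abel

lemma signedStep_hexagon (c : Bool) (i j k : ι) (x : (Bool → ℤˣ) × A) :
    signedStep γ c i (signedStep γ c j (signedStep γ c k x)) =
      signedStep γ c k (signedStep γ c j (signedStep γ c i x)) := by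
  ext
  · simp
  · simp; abel

lemma update_neg_ne (s : Bool → ℤˣ) (c : Bool) : Function.update s c (-s c) ≠ s := by
  intro h
  have := congrFun h c
  simp at this

lemma update_neg_injective {s : Bool → ℤˣ} {c d : Bool}
    (h : Function.update s c (-s c) = Function.update s d (-s d)) : c = d := by
  by_contra hne
  have := congrFun h c
  rw [Function.update_self, Function.update_of_ne hne] at this
  exact units_ne_neg_self _ this.symm

lemma sign_smul_cancel {s : ℤˣ} {a b : A} (h : (s : ℤ) • a = (s : ℤ) • b) : a = b := by
  rcases Int.units_eq_one_or s with rfl | rfl <;> simpa using h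

lemma signedStep_inj (hγ : ∀ c, Function.Injective (γ c)) {c d : Bool} {i j : ι}
    {x : (Bool → ℤˣ) × A} (h : signedStep γ c i x = signedStep γ d j x) : c = d ∧ i = j := by
  obtain rfl : c = d := update_neg_injective (congrArg Prod.fst h)
  refine ⟨rfl, hγ c (sign_smul_cancel (s := x.1 c) ?_)⟩
  simpa using congrArg Prod.snd h

variable (γ) in
/-- The graph on `(Bool → ℤˣ) × A` with edges `x — signedStep γ c i x`. It is a quotient by a copy
of `A` of the Cartesian product of the two bipartite graphs that join `y` to `y + γ c i`, one for
each kind `c`. -/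
def signedGraph : SimpleGraph ((Bool → ℤˣ) × A) where
  Adj x y := ∃ c i, y = signedStep γ c i x
  symm := ⟨by rintro x _ ⟨c, i, rfl⟩; exact ⟨c, i, by simp⟩⟩
  loopless := ⟨by rintro x ⟨c, i, h⟩; exact update_neg_ne _ _ (congrArg Prod.fst h).symm⟩

lemma signedGraph_adj_step (c : Bool) (i : ι) (x : (Bool → ℤˣ) × A) :
    (signedGraph γ).Adj x (signedStep γ c i x) := ⟨c, i, rfl⟩

lemma signedGraph_hasValency [Finite A] (hγ : ∀ c, Function.Injective (γ c)) :
    (signedGraph γ).HasValency (2 * Nat.card ι) := by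
  let lf : (signedGraph γ).LocallyFinite := fun x => Fintype.ofFinite _
  refine ⟨lf, fun x => ?_⟩
  let e : Bool × ι ≃ (signedGraph γ).neighborSet x :=
    Equiv.ofBijective (fun p => ⟨signedStep γ p.1 p.2 x, p.1, p.2, rfl⟩) <| by
      constructor
      · rintro ⟨c, i⟩ ⟨d, j⟩ h
        obtain ⟨rfl, rfl⟩ := signedStep_inj hγ (congrArg Subtype.val h)
        rfl
      · rintro ⟨_, c, i, rfl⟩
        exact ⟨(c, i), rfl⟩
  rw [← card_neighborSet_eq_degree, ← Nat.card_eq_fintype_card, ← Nat.card_congr e,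
    Nat.card_prod]
  simp

/-- A permutation of the vertices that permutes the kinds and the labels of the steps is an
automorphism. -/
def signedIso (f : Equiv.Perm ((Bool → ℤˣ) × A)) (τ : Equiv.Perm Bool) (σ : Equiv.Perm ι)
    (h : ∀ c i x, f (signedStep γ c i x) = signedStep γ (τ c) (σ i) (f x)) :
    signedGraph γ ≃g signedGraph γ where
  toEquiv := f
  map_rel_iff' := by
    intro x y
    constructor
    · rintro ⟨c, i, hy⟩
      refine ⟨τ.symm c, σ.symm i, f.injective ?_⟩
      rw [h, hy]; simp
    · rintro ⟨c, i, rfl⟩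
      exact ⟨τ c, σ i, h c i x⟩

variable (γ) in
/-- Translation of the group coordinate. -/
def signedTranslate (a : A) : signedGraph γ ≃g signedGraph γ :=
  signedIso ((Equiv.refl _).prodCongr (Equiv.addRight a)) 1 1 (by
    intro c i x
    refine Prod.ext ?_ ?_
    · simp
    · simp; abel)

@[simp] lemma signedTranslate_apply (a : A) (x : (Bool → ℤˣ) × A) :
    signedTranslate γ a x = (x.1, x.2 + a) := rfl

variable (γ) in
/-- Negation of both signs and of the group coordinate. -/
def signedNeg : signedGraph γ ≃g signedGraph γ :=
  signedIso ((Equiv.neg _).prodCongr (Equiv.neg A)) 1 1 (by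
    intro c i x
    refine Prod.ext ?_ ?_
    · funext d
      by_cases hd : d = c
      · subst hd; simp
      · simp [hd]
    · simp; abel)

@[simp] lemma signedNeg_apply (x : (Bool → ℤˣ) × A) :
    signedNeg γ x = (-x.1, -x.2) := rfl

/-- The automorphism given by an automorphism of `A` that permutes the labels of both kinds in the
same way. -/
def signedLinear (φ : A ≃+ A) (σ : Equiv.Perm ι) (h : ∀ c i, φ (γ c i) = γ c (σ i)) :
    signedGraph γ ≃g signedGraph γ :=
  signedIso ((Equiv.refl _).prodCongr φ.toEquiv) 1 σ (by
    intro c i x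
    refine Prod.ext ?_ ?_
    · simp
    · simp [h])

@[simp] lemma signedLinear_apply (φ : A ≃+ A) (σ : Equiv.Perm ι)
    (h : ∀ c i, φ (γ c i) = γ c (σ i)) (x : (Bool → ℤˣ) × A) :
    signedLinear φ σ h x = (x.1, φ x.2) := rfl

/-- The automorphism that interchanges the two kinds, given by an automorphism of `A` that
interchanges `γ false` and `γ true`. -/
def signedSwap (θ : A ≃+ A) (h : ∀ c i, θ (γ c i) = γ (!c) i) :
    signedGraph γ ≃g signedGraph γ :=
  signedIso ((Equiv.boolNot.arrowCongr (Equiv.refl _)).prodCongr θ.toEquiv) Equiv.boolNot 1 (by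
    intro c i x
    refine Prod.ext ?_ ?_
    · funext d
      by_cases hd : d = !c
      · subst hd; simp
      · have : (!d) ≠ c := by rintro rfl; simp at hd
        simp [hd, this]
    · simp [h])

lemma signedSwap_apply (θ : A ≃+ A) (h : ∀ c i, θ (γ c i) = γ (!c) i) (x : (Bool → ℤˣ) × A) :
    signedSwap θ h x = (fun c => x.1 !c, θ x.2) := rfl

lemma signedSwap_step (θ : A ≃+ A) (h : ∀ c i, θ (γ c i) = γ (!c) i) (c : Bool) (i : ι)
    (x : (Bool → ℤˣ) × A) :
    signedSwap θ h (signedStep γ c i x) = signedStep γ (!c) i (signedSwap θ h x) := by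
  refine Prod.ext ?_ ?_
  · funext d
    by_cases hd : d = !c
    · subst hd; simp [signedSwap_apply]
    · have : (!d) ≠ c := by rintro rfl; simp at hd
      simp [signedSwap_apply, hd, this]
  · simp [signedSwap_apply, h]

/-- Two steps of kind `c` amount to a translation by a difference of labels, so the graph is
connected when these differences generate `A`. -/
lemma signedGraph_connected [Nonempty ι]
    (h : ∀ a : A, a ∈ AddSubgroup.closure {d | ∃ c i j, d = γ c i - γ c j}) :
    (signedGraph γ).Connected := by
  have htrans : ∀ d : A, ∀ x : (Bool → ℤˣ) × A,
      (signedGraph γ).Reachable x (x.1, x.2 + d) := by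
    intro d
    induction h d using AddSubgroup.closure_induction with
    | mem d hd =>
      obtain ⟨c, i, j, rfl⟩ := hd
      have key : ∀ i j (x : (Bool → ℤˣ) × A), (signedGraph γ).Reachable x
          (x.1, x.2 + (x.1 c : ℤ) • (γ c i - γ c j)) := fun i j x => by
        rw [← signedStep_pair]
        exact (signedGraph_adj_step c i x).reachable.trans (signedGraph_adj_step c j _).reachable
      intro x
      rcases Int.units_eq_one_or (x.1 c) with hs | hs
      · simpa [hs] using key i j x
      · simpa [hs] using key j i x
    | zero => intro x; simp
    | add a b _ _ ha hb =>
      intro x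
      simpa [add_assoc] using (ha x).trans (hb _)
    | neg a _ ha =>
      intro x
      simpa using (ha (x.1, x.2 + -a)).symm
  obtain ⟨i⟩ := ‹Nonempty ι›
  have hflip : ∀ (c : Bool) (x : (Bool → ℤˣ) × A), ∃ y, (signedGraph γ).Reachable x y ∧
      y.1 c = 1 ∧ y.1 (!c) = x.1 (!c) := by
    intro c x
    rcases Int.units_eq_one_or (x.1 c) with hs | hs
    · exact ⟨x, .rfl, hs, rfl⟩
    · exact ⟨_, (signedGraph_adj_step c i x).reachable, by simp [hs], by simp⟩
  have hbase : ∀ x, (signedGraph γ).Reachable x (1, 0) := by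
    intro x
    obtain ⟨y, hxy, hy, -⟩ := hflip true x
    obtain ⟨z, hyz, hz, hz'⟩ := hflip false y
    have hz1 : z.1 = 1 := by
      funext c
      cases c
      · exact hz
      · simpa using hz'.trans hy
    have := htrans (-z.2) z
    rw [hz1, add_neg_cancel] at this
    exact (hxy.trans hyz).trans this
  have : Nonempty ((Bool → ℤˣ) × A) := ⟨(1, 0)⟩
  exact ⟨fun x y => (hbase x).trans (hbase y).symm⟩

variable (γ) in
/-- The dihedral group acts by translations and by negation of all coordinates. -/
def signedDihedral {n : ℕ} (e : ZMod n ≃+ A) : DihedralGroup n →* (signedGraph γ ≃g signedGraph γ)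
    where
  toFun
    | .r i => signedTranslate γ (e i)
    | .sr i => signedNeg γ * signedTranslate γ (e i)
  map_one' := by
    change signedTranslate γ (e 0) = 1
    ext x <;> simp
  map_mul' := by
    rintro (i | i) (j | j) <;> simp only [DihedralGroup.r_mul_r, DihedralGroup.r_mul_sr,
      DihedralGroup.sr_mul_r, DihedralGroup.sr_mul_sr] <;> ext x <;>
      simp [RelIso.mul_apply] <;> abel

lemma signedGraph_isBiDihedrant {n : ℕ} (hn : 3 ≤ n) (e : ZMod n ≃+ A) :
    (signedGraph γ).IsBiDihedrant := by
  refine ⟨n, hn, signedDihedral γ e, ?_, (1, 0), (Function.update (1 : Bool → ℤˣ) false (-1), 0), ?_, ?_⟩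
  · rintro (i | i) x h
    · have h2 : x.2 + e i = x.2 := congrArg Prod.snd h
      have : i = 0 := by simpa using h2
      rw [this]; rfl
    · have h1 : -x.1 = x.1 := congrArg Prod.fst h
      exact absurd (congrFun h1 true).symm (units_ne_neg_self _)
  · rintro (i | i) h
    · have h1 : (1 : Bool → ℤˣ) = Function.update (1 : Bool → ℤˣ) false (-1) := congrArg Prod.fst h
      simpa using congrFun h1 false
    · have h1 : -(1 : Bool → ℤˣ) = Function.update (1 : Bool → ℤˣ) false (-1) := congrArg Prod.fst h
      simpa using congrFun h1 true
  · rintro ⟨s, y⟩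
    have hs : ∀ t : Bool → ℤˣ, t false = s false → t true = s true → t = s := by
      intro t h0 h1; funext c; cases c <;> assumption
    rcases Int.units_eq_one_or (s false) with h0 | h0 <;>
      rcases Int.units_eq_one_or (s true) with h1 | h1
    · exact .inl ⟨.r (e.symm y), Prod.ext (hs _ h0.symm h1.symm)
        (by change 0 + e (e.symm y) = y; simp)⟩
    · exact .inr ⟨.sr (e.symm (-y)), Prod.ext
        (hs _ (by rw [h0]; rfl) (by rw [h1]; rfl))
        (by change -(0 + e (e.symm (-y))) = y; simp)⟩
    · exact .inr ⟨.r (e.symm y), Prod.ext (hs _ h0.symm h1.symm)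
        (by change 0 + e (e.symm y) = y; simp)⟩
    · exact .inl ⟨.sr (e.symm (-y)), Prod.ext
        (hs _ (by rw [h0]; rfl) (by rw [h1]; rfl))
        (by change -(0 + e (e.symm (-y))) = y; simp)⟩

lemma signedGraph_isEdgeTransitive
    (hlin : ∀ i j, ∃ (φ : A ≃+ A) (σ : Equiv.Perm ι), (∀ c l, φ (γ c l) = γ c (σ l)) ∧ σ i = j)
    (hswap : ∃ θ : A ≃+ A, ∀ c i, θ (γ c i) = γ (!c) i) :
    (signedGraph γ).IsEdgeTransitive := by
  obtain ⟨θ, hθ⟩ := hswap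
  have hbase : signedSwap θ hθ (1, 0) = (1, 0) := Prod.ext rfl (map_zero θ)
  -- every edge is an image of an edge of kind `false` at the base vertex
  have h1 : ∀ (c : Bool) (i : ι) (x : (Bool → ℤˣ) × A), x.1 false = x.1 true →
      ∃ f : signedGraph γ ≃g signedGraph γ, f (1, 0) = x ∧
        f (signedStep γ false i (1, 0)) = signedStep γ c i x := by
    have h2 : ∀ (i : ι) (x : (Bool → ℤˣ) × A), x.1 false = x.1 true →
      ∃ f : signedGraph γ ≃g signedGraph γ, f (1, 0) = x ∧
        ∀ c, f (signedStep γ c i (1, 0)) = signedStep γ c i x := by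
      rintro i ⟨s, y⟩ h
      rcases Int.units_eq_one_or (s false) with h0 | h0
      · obtain rfl : s = 1 := by
          funext c
          cases c
          · exact h0
          · exact h.symm.trans h0
        refine ⟨signedTranslate γ y, by simp, fun c => Prod.ext ?_ ?_⟩ <;> simp [add_comm]
      · obtain rfl : s = -1 := by
          funext c
          cases c
          · exact h0
          · exact h.symm.trans h0
        refine ⟨signedTranslate γ y * signedNeg γ, by simp [RelIso.mul_apply], fun c =>
          Prod.ext ?_ ?_⟩
        · funext d
          by_cases hd : d = c
          · subst hd; simp [RelIso.mul_apply]
          · simp [RelIso.mul_apply, hd]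
        · simp [RelIso.mul_apply, add_comm]
    intro c i x hx
    obtain ⟨f, hf, hf'⟩ := h2 i x hx
    cases c
    · exact ⟨f, hf, hf' _⟩
    · refine ⟨f * signedSwap θ hθ, ?_, ?_⟩
      · rw [RelIso.mul_apply, hbase, hf]
      · rw [RelIso.mul_apply, signedSwap_step, hbase, ← hf']; rfl
  have h3 : ∀ (e : (signedGraph γ).edgeSet) (j : ι), ∃ f : signedGraph γ ≃g signedGraph γ,
      f.mapEdgeSet ⟨s((1, 0), signedStep γ false j (1, 0)), signedGraph_adj_step false j _⟩ =
        e := by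
    rintro ⟨e, he⟩ j
    induction e using Sym2.ind with
    | h x y =>
    obtain ⟨c, i, hy⟩ : ∃ c i, y = signedStep γ c i x := he
    subst hy
    obtain ⟨φ, σ, hφ, rfl⟩ := hlin j i
    have h4 : ∀ x : (Bool → ℤˣ) × A, x.1 false = x.1 true →
        ∃ f : signedGraph γ ≃g signedGraph γ, f (1, 0) = x ∧
          f (signedStep γ false j (1, 0)) = signedStep γ c (σ j) x := by
      intro x hx
      obtain ⟨f, hf, hf'⟩ := h1 c (σ j) x hx
      refine ⟨f * signedLinear φ σ hφ, ?_, ?_⟩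
      · simpa [RelIso.mul_apply] using hf
      · rw [← hf', RelIso.mul_apply]
        congr 1
        simp [signedStep, hφ]
    by_cases hx : x.1 false = x.1 true
    · obtain ⟨f, hf, hf'⟩ := h4 x hx
      exact ⟨f, Subtype.ext (by simp [hf, hf'])⟩
    · obtain ⟨f, hf, hf'⟩ := h4 (signedStep γ c (σ j) x) (by
        have : x.1 false = -x.1 true := by
          rcases Int.units_eq_one_or (x.1 false) with h | h <;>
            rcases Int.units_eq_one_or (x.1 true) with h' | h' <;> simp_all
        cases c <;> simp [this])
      rw [signedStep_signedStep] at hf'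
      exact ⟨f, Subtype.ext (by simp [hf, hf', Sym2.eq_swap])⟩
  intro e₁ e₂
  obtain ⟨j⟩ : Nonempty ι := by
    obtain ⟨e, he⟩ := e₁
    induction e using Sym2.ind with
    | h x y => exact ⟨he.choose_spec.choose⟩
  obtain ⟨f₁, h₁⟩ := h3 e₁ j
  obtain ⟨f₂, h₂⟩ := h3 e₂ j
  refine ⟨f₁.symm.trans f₂, ?_⟩
  rw [← h₁, ← h₂]
  exact Subtype.ext (by simp)

end SignedGraph

/-! ### Valency `2k`: graphs over a prime field with twins in one half -/

section PrimeField

variable {p : ℕ} [Fact p.Prime]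

/-- The labels `± κ` for `κ` in a subgroup `K` of the multiplicative group of a prime field, with
the sign given by the kind. -/
def subgroupLabel (K : Subgroup (ZMod p)ˣ) (c : Bool) (κ : K) : ZMod p :=
  if c then -((κ : (ZMod p)ˣ) : ZMod p) else ((κ : (ZMod p)ˣ) : ZMod p)

lemma subgroupLabel_injective (K : Subgroup (ZMod p)ˣ) (c : Bool) :
    Function.Injective (subgroupLabel K c) := by
  intro a b h
  cases c <;> simpa [subgroupLabel, Units.val_inj] using h

/-- A coset `y + K` or `y - K` of a nontrivial subgroup `K` of odd order equals `-K` only in the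
obvious case, since the elements of `K` add up to zero. -/
lemma eq_one_and_eq_zero_of_neg_eq_add {K : Subgroup (ZMod p)ˣ} (hodd : Odd (Nat.card K))
    (hK : 1 < Nat.card K) (hp : Nat.card K < p) {s : ℤˣ} {y : ZMod p}
    (h : ∀ κ : K, ∃ κ' : K, -((κ : (ZMod p)ˣ) : ZMod p) =
      y - (s : ℤ) • ((κ' : (ZMod p)ˣ) : ZMod p)) : s = 1 ∧ y = 0 := by
  choose σ hσ using h
  have hinj : Function.Injective σ := by
    intro a b hab
    exact Subtype.ext (Units.ext (neg_injective ((hσ a).trans (by rw [hab, ← hσ b]))))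
  have hbij : Function.Bijective σ := Finite.injective_iff_bijective.mp hinj
  let _ : Fintype K := Fintype.ofFinite K
  have hsum : ∑ κ : K, ((κ : (ZMod p)ˣ) : ZMod p) = 0 := by
    refine sum_hom_units_eq_zero ((Units.coeHom (ZMod p)).comp K.subtype) ?_
    intro h1
    have : Subsingleton K := ⟨fun a b => by
      have ha := DFunLike.congr_fun h1 a
      have hb := DFunLike.congr_fun h1 b
      simp at ha hb
      exact ha.trans hb.symm⟩
    have := Finite.card_le_one_iff_subsingleton (α := K) |>.mpr this
    omega
  have hy : y = 0 := by
    have h1 : ∑ κ : K, -((κ : (ZMod p)ˣ) : ZMod p) =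
        ∑ κ : K, (y - (s : ℤ) • ((σ κ : (ZMod p)ˣ) : ZMod p)) :=
      Finset.sum_congr rfl fun κ _ => hσ κ
    rw [Finset.sum_neg_distrib, Finset.sum_sub_distrib, ← Finset.smul_sum,
      hbij.sum_comp (fun κ : K => ((κ : (ZMod p)ˣ) : ZMod p)), hsum, Finset.sum_const,
      Finset.card_univ, ← Nat.card_eq_fintype_card, nsmul_eq_mul] at h1
    simp only [neg_zero, smul_zero, sub_zero] at h1
    rcases mul_eq_zero.mp h1.symm with h2 | h2
    · rw [ZMod.natCast_eq_zero_iff] at h2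
      exact absurd (Nat.le_of_dvd (by omega) h2) (by omega)
    · exact h2
  refine ⟨?_, hy⟩
  rcases Int.units_eq_one_or s with rfl | rfl
  · rfl
  · exfalso
    have h1 : ((σ 1 : (ZMod p)ˣ) : ZMod p) = -1 := by
      have := hσ 1
      simp [hy] at this
      exact this.symm
    have h2 : (σ 1) ^ Nat.card K = 1 := pow_card_eq_one'
    have h3 : ((σ 1 : (ZMod p)ˣ) : ZMod p) ^ Nat.card K = 1 := by
      rw [← Units.val_pow_eq_pow_val, ← Subgroup.coe_pow, h2]; rfl
    rw [h1, hodd.neg_one_pow] at h3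
    have : Fact (2 < p) := ⟨by omega⟩
    exact ZMod.neg_one_ne_one h3

/-- The two vertices with group coordinate `0` and constant sign have the same neighbours. -/
lemma subgroupLabel_twin (K : Subgroup (ZMod p)ˣ) (v : (Bool → ℤˣ) × ZMod p) :
    (signedGraph (subgroupLabel K)).Adj (1, 0) v ↔
      (signedGraph (subgroupLabel K)).Adj (-1, 0) v := by
  have h : ∀ c κ, signedStep (subgroupLabel K) c κ (1, 0) =
      signedStep (subgroupLabel K) (!c) κ (-1, 0) := by
    intro c κ
    refine Prod.ext ?_ ?_
    · funext d
      cases c <;> cases d <;> simp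
    · cases c <;> simp [subgroupLabel]
  constructor
  · rintro ⟨c, κ, rfl⟩
    exact ⟨!c, κ, h c κ⟩
  · rintro ⟨c, κ, rfl⟩
    exact ⟨!c, κ, by rw [h, Bool.not_not]⟩

lemma subgroupLabel_eq_of_twin {K : Subgroup (ZMod p)ˣ} (hodd : Odd (Nat.card K))
    (hK : 1 < Nat.card K) (hp : Nat.card K < p) {x : (Bool → ℤˣ) × ZMod p}
    (h : ∀ v, (signedGraph (subgroupLabel K)).Adj (Function.update (1 : Bool → ℤˣ) false (-1), 0) v →
      (signedGraph (subgroupLabel K)).Adj x v) :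
    x = (Function.update (1 : Bool → ℤˣ) false (-1), 0) := by
  obtain ⟨s, y⟩ := x
  have h1 : ∀ κ : K, (signedGraph (subgroupLabel K)).Adj (s, y)
      (1, -((κ : (ZMod p)ˣ) : ZMod p)) := by
    intro κ
    apply h
    refine ⟨false, κ, Prod.ext ?_ ?_⟩ <;> simp [subgroupLabel]
  obtain ⟨c, κ₀, hc⟩ := h1 1
  -- the kind `c` of the edges at `x` is the coordinate in which its signs are negative
  have hs : s = Function.update (1 : Bool → ℤˣ) c (-1) := by
    have h2 : (1 : Bool → ℤˣ) = Function.update s c (-s c) := congrArg Prod.fst hc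
    funext d
    have h3 := congrFun h2 d
    by_cases hd : d = c
    · subst hd
      simp at h3 ⊢
      rw [h3, neg_neg]
    · simp [hd] at h3 ⊢
      exact h3.symm
  have hcoset : ∀ κ : K, ∃ κ' : K, -((κ : (ZMod p)ˣ) : ZMod p) =
      y - (((if c then -1 else 1 : ℤˣ)) : ℤ) • ((κ' : (ZMod p)ˣ) : ZMod p) := by
    intro κ
    obtain ⟨d, κ', hd⟩ := h1 κ
    obtain rfl : d = c := update_neg_injective
      ((congrArg Prod.fst hd).symm.trans (congrArg Prod.fst hc))
    refine ⟨κ', ?_⟩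
    have h2 : -((κ : (ZMod p)ˣ) : ZMod p) = y + (s d : ℤ) • subgroupLabel K d κ' :=
      congrArg Prod.snd hd
    rw [h2, hs]
    cases d
    · simp [subgroupLabel]; ring
    · simp [subgroupLabel]
  obtain ⟨h2, rfl⟩ := eq_one_and_eq_zero_of_neg_eq_add hodd hK hp hcoset
  cases c
  · rw [hs]
  · exact absurd h2 (by decide)

theorem subgroupLabel_isSemisymmetric {K : Subgroup (ZMod p)ˣ} (hodd : Odd (Nat.card K))
    (hK : 1 < Nat.card K) (hp : Nat.card K < p) :
    (signedGraph (subgroupLabel K)).IsSemisymmetric := by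
  refine ⟨⟨_, signedGraph_hasValency (subgroupLabel_injective K)⟩,
    signedGraph_isEdgeTransitive ?_ ?_, ?_⟩
  · intro i j
    refine ⟨AddAut.mulLeft ((j * i⁻¹ : K) : (ZMod p)ˣ), Equiv.mulLeft (j * i⁻¹), ?_, by simp⟩
    intro c l
    have h : ((j * i⁻¹ : K) : (ZMod p)ˣ) • ((l : (ZMod p)ˣ) : ZMod p) =
        (((j * i⁻¹ * l : K) : (ZMod p)ˣ) : ZMod p) := by
      rw [Units.smul_def, smul_eq_mul, Subgroup.coe_mul _ _ l, Units.val_mul]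
    cases c
    · exact h
    · exact (smul_neg _ _).trans (congrArg _ h)
  · exact ⟨AddEquiv.neg _, fun c i => by cases c <;> simp [subgroupLabel]⟩
  · intro hvt
    obtain ⟨f, hf⟩ := hvt (1, 0) (Function.update (1 : Bool → ℤˣ) false (-1), 0)
    have h : f (-1, 0) = f (1, 0) := by
      rw [hf]
      refine subgroupLabel_eq_of_twin hodd hK hp fun v hv => ?_
      obtain ⟨v, rfl⟩ := f.surjective v
      rw [← hf, f.map_adj_iff] at hv
      rw [f.map_adj_iff]
      exact (subgroupLabel_twin K v).mp hv
    have h1 : (-1 : Bool → ℤˣ) = 1 := congrArg Prod.fst (f.injective h)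
    exact absurd (congrFun h1 true) (by decide)

lemma subgroupLabel_connected {K : Subgroup (ZMod p)ˣ} (hK : 1 < Nat.card K) :
    (signedGraph (subgroupLabel K)).Connected := by
  refine signedGraph_connected fun a => ?_
  have : Nontrivial K := Finite.one_lt_card_iff_nontrivial.mp hK
  obtain ⟨κ, hκ⟩ := exists_ne (1 : K)
  have hne : ((κ : (ZMod p)ˣ) : ZMod p) - 1 ≠ 0 := by
    intro h
    apply hκ
    simpa [sub_eq_zero] using h
  have h1 := AddSubgroup.nsmul_mem _ (AddSubgroup.subset_closure
    (k := {d | ∃ c i j, d = subgroupLabel K c i - subgroupLabel K c j})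
    ⟨false, κ, 1, rfl⟩) (a / (((κ : (ZMod p)ˣ) : ZMod p) - 1)).val
  simpa [subgroupLabel, hne] using h1

lemma exists_semisymmetric_of_odd {k : ℕ} (hk : Odd k) (h3 : 3 ≤ k) :
    ∃ (V : Type) (_ : Finite V) (Γ : SimpleGraph V),
      Γ.Connected ∧ Γ.IsBiDihedrant ∧ Γ.IsSemisymmetric ∧ Γ.HasValency (2 * k) := by
  obtain ⟨p, hp, hpk, hmod⟩ := Nat.exists_prime_gt_modEq_one (k := k) k (by omega)
  have : Fact p.Prime := ⟨hp⟩
  have hdvd : k ∣ Nat.card (ZMod p)ˣ := by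
    rw [Nat.card_eq_fintype_card, ZMod.card_units]
    exact (Nat.modEq_iff_dvd' hp.one_lt.le).mp hmod.symm
  obtain ⟨K, hK⟩ : ∃ K : Subgroup (ZMod p)ˣ, Nat.card K = k := by
    obtain ⟨g, hg⟩ := IsCyclic.exists_ofOrder_eq_natCard (α := (ZMod p)ˣ)
    refine ⟨Subgroup.zpowers (g ^ (Nat.card (ZMod p)ˣ / k)), ?_⟩
    rw [Nat.card_zpowers, orderOf_pow_of_dvd, hg, Nat.div_div_self hdvd Nat.card_pos.ne']
    · exact (Nat.div_pos (Nat.le_of_dvd Nat.card_pos hdvd) (by omega)).ne'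
    · rw [hg]; exact Nat.div_dvd_of_dvd hdvd
  have hinj := subgroupLabel_injective K
  refine ⟨_, inferInstance, signedGraph (subgroupLabel K),
    subgroupLabel_connected (by omega), signedGraph_isBiDihedrant (by omega) (AddEquiv.refl _),
    subgroupLabel_isSemisymmetric (hK ▸ hk) (by omega) (by omega), ?_⟩
  rw [← hK]
  exact signedGraph_hasValency hinj

end PrimeField

/-! ### Rigidity: automorphisms respect kinds and labels -/

section Rigidity

variable {A ι : Type*} [AddCommGroup A]

/-- Conditions on the labels that exclude accidental short cycles of `signedGraph γ`. The first two
say that every 4-cycle has two edges of each kind. The third says that a path of length three of one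
kind with labels `a, b, a` shares its ends only with paths of that kind and length that start
with the same edge, whereas labels `i, j, k` and `k, j, i` always give two paths with equal ends. -/
structure IsGenericLabel (γ : Bool → ι → A) : Prop where
  eq_of_sub_eq_sub : ∀ c i j k l, i ≠ j → γ c i - γ c k = γ c j - γ c l → k = i
  eq_of_smul_sub_eq : ∀ (c d : Bool) (s t : ℤˣ) (i j k l : ι), c ≠ d →
    (s : ℤ) • (γ c i - γ c j) = (t : ℤ) • (γ d k - γ d l) → i = j
  eq_of_path_three : ∀ c a b i j k, a ≠ b → γ c a - γ c b + γ c a = γ c i - γ c j + γ c k → i = a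

namespace IsGenericLabel

variable {γ : Bool → ι → A} (hγ : IsGenericLabel γ)
include hγ

lemma injective (c : Bool) : Function.Injective (γ c) := by
  intro i j h
  by_contra hij
  exact hij (hγ.eq_of_sub_eq_sub c i j j i hij (by rw [h])).symm

/-- Distinct neighbours of `x` of equal kind have no common neighbour but `x`. -/
lemma eq_of_adj_of_adj {c : Bool} {i j : ι} (hij : i ≠ j) {x z : (Bool → ℤˣ) × A}
    (h₁ : (signedGraph γ).Adj (signedStep γ c i x) z)
    (h₂ : (signedGraph γ).Adj (signedStep γ c j x) z) : z = x := by
  obtain ⟨d, k, rfl⟩ := h₁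
  obtain ⟨d', l, h⟩ := h₂
  obtain rfl : d = d' := update_neg_injective (congrArg Prod.fst h)
  by_cases hd : c = d
  · subst hd
    simp only [signedStep_pair] at h ⊢
    have h1 := sign_smul_cancel (add_left_cancel (congrArg Prod.snd h))
    obtain rfl := hγ.eq_of_sub_eq_sub c i j k l hij h1
    simp
  · exfalso
    apply hij
    refine hγ.eq_of_smul_sub_eq c d (x.1 c) (x.1 d) i j l k hd ?_
    have h1 := congrArg Prod.snd h
    simp only [signedStep_snd, signedStep_fst, Function.update_of_ne (Ne.symm hd)] at h1
    rw [smul_sub, smul_sub, sub_eq_sub_iff_add_eq_add]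
    rw [add_assoc, add_assoc] at h1
    rw [add_left_cancel h1, add_comm]

variable (g : signedGraph γ ≃g signedGraph γ)

lemma kind_eq_iff {c d c' d' : Bool} {i j i' j' : ι} {x : (Bool → ℤˣ) × A}
    (hne : signedStep γ c i x ≠ signedStep γ d j x)
    (h₁ : g (signedStep γ c i x) = signedStep γ c' i' (g x))
    (h₂ : g (signedStep γ d j x) = signedStep γ d' j' (g x)) : c = d ↔ c' = d' := by
  -- neighbours of different kinds have two common neighbours, neighbours of equal kind only one
  have key : ∀ (f : signedGraph γ ≃g signedGraph γ) {c d c' d' : Bool} {i j i' j' : ι}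
      {x : (Bool → ℤˣ) × A}, signedStep γ c i x ≠ signedStep γ d j x →
      f (signedStep γ c i x) = signedStep γ c' i' (f x) →
      f (signedStep γ d j x) = signedStep γ d' j' (f x) → c ≠ d → c' ≠ d' := by
    intro f c d c' d' i j i' j' x hne h₁ h₂ hcd hcd'
    subst hcd'
    have hij : i' ≠ j' := by
      rintro rfl
      exact hne (f.injective (h₁.trans h₂.symm))
    have h3 := hγ.eq_of_adj_of_adj hij (x := f x)
      (z := f (signedStep γ c i (signedStep γ d j x)))
      (by rw [← h₁, f.map_adj_iff, signedStep_comm hcd]; exact signedGraph_adj_step _ _ _)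
      (by rw [← h₂, f.map_adj_iff]; exact signedGraph_adj_step _ _ _)
    have h4 := congrFun (congrArg Prod.fst (f.injective h3)) c
    simp [Function.update_of_ne hcd] at h4
  constructor
  · contrapose
    have e : ∀ y, g.symm (g y) = y := g.symm_apply_apply
    refine key g.symm (x := g x) (i := i') (j := j') (i' := i) (j' := j) ?_ ?_ ?_
    · rw [← h₁, ← h₂]
      exact fun h => hne (g.injective h)
    · rw [← h₁, e, e]
    · rw [← h₂, e, e]
  · contrapose
    exact key g hne h₁ h₂

lemma kind_preserved [Nontrivial ι] {x : (Bool → ℤˣ) × A} {c : Bool} {i i' : ι}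
    (h : g (signedStep γ c i x) = signedStep γ c i' (g x)) (d : Bool) (j : ι) :
    ∃ j', g (signedStep γ d j x) = signedStep γ d j' (g x) := by
  obtain ⟨d', j', hj⟩ : ∃ d' j', g (signedStep γ d j x) = signedStep γ d' j' (g x) :=
    g.map_adj_iff.mpr (signedGraph_adj_step d j x)
  suffices d' = d from ⟨j', this ▸ hj⟩
  by_cases hne : signedStep γ c i x = signedStep γ d j x
  · obtain ⟨rfl, rfl⟩ := signedStep_inj hγ.injective hne
    exact (signedStep_inj hγ.injective (h.symm.trans hj)).1.symm
  · have := hγ.kind_eq_iff g hne h hj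
    cases c <;> cases d <;> cases d' <;> simp_all

/-- An automorphism that preserves the kind of one edge preserves the kinds of all edges. -/
lemma kind_preserved_all [Nontrivial ι] (hconn : (signedGraph γ).Connected)
    {x : (Bool → ℤˣ) × A} {c : Bool} {i i' : ι}
    (h : g (signedStep γ c i x) = signedStep γ c i' (g x)) (y : (Bool → ℤˣ) × A) :
    ∀ d j, ∃ j', g (signedStep γ d j y) = signedStep γ d j' (g y) := by
  have hr := hconn.preconnected x y
  rw [reachable_iff_reflTransGen] at hr
  induction hr with
  | refl => exact hγ.kind_preserved g h
  | @tail b y _ hby ih =>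
    obtain ⟨d, j, rfl⟩ := hby
    obtain ⟨j', hj⟩ := ih d j
    refine hγ.kind_preserved g (c := d) (i := j) (i' := j') ?_
    rw [hj]; simp

/-- If an automorphism permutes the labels at `x` by `π` and at an adjacent vertex by `π'`, then
`π' = π`: the 4-cycles through the edge show it for labels of the other kind, and the hexagons
through the edge for labels of the same kind. -/
lemma labelMap_step (hι : ∀ i j : ι, i ≠ j → ∃ k, k ≠ i ∧ k ≠ j ∧ ∀ l, l = i ∨ l = j ∨ l = k)
    {π : (Bool → ℤˣ) × A → Bool → ι → ι}
    (hπ : ∀ x c i, g (signedStep γ c i x) = signedStep γ c (π x c i) (g x))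
    (x : (Bool → ℤˣ) × A) (d : Bool) (j : ι) : π (signedStep γ d j x) = π x := by
  have hinj : ∀ x c, Function.Injective (π x c) := by
    intro x c a b h
    have := (hπ x c a).trans ((congrArg (fun t => signedStep γ c t (g x)) h).trans (hπ x c b).symm)
    exact (signedStep_inj hγ.injective (g.injective this)).2
  have hsame : ∀ x d j, π (signedStep γ d j x) d j = π x d j := by
    intro x d j
    have h1 := hπ (signedStep γ d j x) d j
    rw [signedStep_signedStep, hπ x d j] at h1
    have h2 := congrArg (signedStep γ d (π (signedStep γ d j x) d j)) h1
    rw [signedStep_signedStep] at h2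
    exact (signedStep_inj hγ.injective h2).2
  funext c i
  by_cases hcd : c = d
  · subst hcd
    by_cases hij : i = j
    · subst hij; exact hsame x c i
    · obtain ⟨k, hki, hkj, hk⟩ := hι i j hij
      -- the two paths of length three from `u` to its antipode in a hexagon
      obtain ⟨u, hu⟩ : ∃ u, u = signedStep γ c k x := ⟨_, rfl⟩
      have hx : x = signedStep γ c k u := by rw [hu, signedStep_signedStep]
      have hhex := congrArg g (signedStep_hexagon (γ := γ) c i j k u)
      rw [← hx, hπ, hπ, hπ, hπ, hπ] at hhex
      have hgx : g x = signedStep γ c (π x c k) (g u) := by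
        rw [hu, hπ, signedStep_signedStep]
      have hpu : π u c i ≠ π x c k := by
        rw [← hsame x c k, ← hu]
        exact fun h => hki (hinj _ _ h).symm
      have hjk : π x c k ≠ π x c j := fun h => hkj (hinj _ _ h)
      have h1 : π (signedStep γ c j x) c i ≠ π x c k := by
        intro h
        rw [h, hgx] at hhex
        apply hpu
        refine hγ.eq_of_path_three c _ _ (π u c i) (π (signedStep γ c i u) c j)
          (π (signedStep γ c j (signedStep γ c i u)) c k) hjk ?_
        have h2 := congrArg Prod.snd hhex
        simp only [signedStep_snd, signedStep_fst, Function.update_self, Units.val_neg, neg_smul,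
          neg_neg, add_assoc] at h2
        have h3 := add_left_cancel h2
        apply sign_smul_cancel (s := (g u).1 c)
        simpa only [smul_add, smul_sub, smul_neg, sub_eq_add_neg, add_assoc] using h3
      have h2 : π (signedStep γ c j x) c i ≠ π x c j := by
        rw [← hsame x c j]
        exact fun h => hij (hinj _ _ h)
      have hsurj : ∃ l, π x c l = π (signedStep γ c j x) c i := by
        have : Finite ι := Set.finite_univ_iff.mp
          ((Set.toFinite {i, j, k}).subset fun l _ => by simpa using hk l)
        exact (Finite.injective_iff_surjective.mp (hinj x c)) _
      obtain ⟨l, hl⟩ := hsurj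
      rcases hk l with rfl | rfl | rfl
      · exact hl.symm
      · exact absurd hl.symm h2
      · exact absurd hl.symm h1
  · have h1 := congrArg g (signedStep_comm (γ := γ) hcd i j x)
    rw [hπ, hπ, hπ, hπ] at h1
    by_contra hne
    apply hne
    refine hγ.eq_of_smul_sub_eq c d ((g x).1 c) ((g x).1 d) _ _
      (π (signedStep γ c i x) d j) (π x d j) hcd ?_
    have h2 := congrArg Prod.snd h1
    simp only [signedStep_snd, signedStep_fst, Function.update_of_ne hcd,
      Function.update_of_ne (Ne.symm hcd), add_assoc] at h2
    have h3 := add_left_cancel h2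
    rw [smul_sub, smul_sub, sub_eq_sub_iff_add_eq_add, add_comm, h3, add_comm]

/-- For three labels of each kind, an automorphism that preserves the kind of some edge acts on the
labels of each kind by one permutation, the same at all vertices. -/
theorem exists_labelMap (hι : ∀ i j : ι, i ≠ j → ∃ k, k ≠ i ∧ k ≠ j ∧ ∀ l, l = i ∨ l = j ∨ l = k)
    [Nontrivial ι] (hconn : (signedGraph γ).Connected) {x : (Bool → ℤˣ) × A} {c : Bool} {i i' : ι}
    (h : g (signedStep γ c i x) = signedStep γ c i' (g x)) :
    ∃ π : Bool → ι → ι, (∀ c, Function.Injective (π c)) ∧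
      ∀ y c i, g (signedStep γ c i y) = signedStep γ c (π c i) (g y) := by
  choose π hπ using hγ.kind_preserved_all g hconn h
  have hconst : ∀ y, π y = π x := by
    intro y
    have hr := hconn.preconnected x y
    rw [reachable_iff_reflTransGen] at hr
    induction hr with
    | refl => rfl
    | @tail b y _ hby ih =>
      obtain ⟨d, j, rfl⟩ := hby
      rw [hγ.labelMap_step g hι hπ, ih]
  refine ⟨π x, fun c a b hab => ?_, fun y c i => by rw [hπ, hconst]⟩
  have := (hπ x c a).trans ((congrArg (fun t => signedStep γ c t (g x)) hab).trans (hπ x c b).symm)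
  exact (signedStep_inj hγ.injective (g.injective this)).2

omit hγ in
/-- An automorphism that fixes a vertex and all labels is trivial. -/
lemma eq_one_of_labels_fixed (hconn : (signedGraph γ).Connected) {x : (Bool → ℤˣ) × A}
    (hx : g x = x) (h : ∀ y c i, g (signedStep γ c i y) = signedStep γ c i (g y)) : g = 1 := by
  ext1 y
  change g y = y
  have hr := hconn.preconnected x y
  rw [reachable_iff_reflTransGen] at hr
  induction hr with
  | refl => exact hx
  | @tail b y _ hby ih =>
    obtain ⟨d, j, rfl⟩ := hby
    rw [h, ih]

end IsGenericLabel

end Rigidity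

/-! ### Edge-regular graphs of valency six -/

section ValencySix

/-- The labels of the graphs of valency six, before reduction: the powers of the cube root of unity
`2` of `ZMod 7`, and `±` the powers of a formal cube root of unity in the basis `1, ω` of the
Eisenstein integers, with the sign given by the kind. -/
def eisensteinVec (c : Bool) (i : Fin 3) : ZMod 7 × ℤ × ℤ :=
  (![1, 2, 4] i, (if c then -1 else 1 : ℤ) • (![(1, 0), (0, 1), (-1, -1)] : Fin 3 → ℤ × ℤ) i)

/-- Evaluation of the formal cube root of unity at the cube root of unity `m` modulo
`m ^ 2 + m + 1`. -/
def eisensteinEval (m : ℕ) : ZMod 7 × ℤ × ℤ →+ ZMod 7 × ZMod (m ^ 2 + m + 1) where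
  toFun v := (v.1, (v.2.1 : ZMod (m ^ 2 + m + 1)) + v.2.2 * m)
  map_zero' := by simp
  map_add' v w := by
    refine Prod.ext rfl ?_
    simp; ring

/-- The labels of the graphs of valency six. -/
def eisensteinLabel (m : ℕ) (c : Bool) (i : Fin 3) : ZMod 7 × ZMod (m ^ 2 + m + 1) :=
  eisensteinEval m (eisensteinVec c i)

/-- A vector with short Eisenstein part. The bound covers all combinations of labels that the
rigidity argument compares. -/
abbrev EisensteinSmall (v : ZMod 7 × ℤ × ℤ) : Prop := |v.2.1| ≤ 40 ∧ |v.2.2| ≤ 40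

lemma eq_of_eisensteinEval_eq {m : ℕ} (hm : 100 ≤ m) {v w : ZMod 7 × ℤ × ℤ}
    (hs : EisensteinSmall (v - w)) (h : eisensteinEval m v = eisensteinEval m w) : v = w := by
  rw [← sub_eq_zero, ← map_sub] at h
  rw [← sub_eq_zero]
  generalize v - w = u at *
  obtain ⟨z, x, y⟩ := u
  obtain ⟨hx, hy⟩ := hs
  have hz : z = 0 := congrArg Prod.fst h
  have h2 : (x : ZMod (m ^ 2 + m + 1)) + y * m = 0 := congrArg Prod.snd h
  have h3 : ((m ^ 2 + m + 1 : ℕ) : ℤ) ∣ x + y * m := by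
    rw [← ZMod.intCast_zmod_eq_zero_iff_dvd]
    push_cast
    exact h2
  simp only [abs_le] at hx hy
  have hm' : (100 : ℤ) ≤ m := by exact_mod_cast hm
  have h4 : x + y * m = 0 := by
    refine Int.eq_zero_of_abs_lt_dvd h3 ?_
    push_cast
    rw [abs_lt]
    constructor <;> nlinarith
  have hy0 : y = 0 := by
    by_contra hne
    rcases lt_or_gt_of_ne hne with hlt | hgt <;> nlinarith
  subst hy0
  simp only [zero_mul, add_zero] at h4
  rw [hz, h4]; rfl

lemma eisensteinLabel_isGeneric {m : ℕ} (hm : 100 ≤ m) : IsGenericLabel (eisensteinLabel m) where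
  eq_of_sub_eq_sub c i j k l hij h := by
    have key : ∀ c i j k l, i ≠ j →
        EisensteinSmall (eisensteinVec c i - eisensteinVec c k -
          (eisensteinVec c j - eisensteinVec c l)) ∧
        (eisensteinVec c i - eisensteinVec c k = eisensteinVec c j - eisensteinVec c l →
          k = i) := by
      decide +kernel
    simp only [eisensteinLabel, ← map_sub] at h
    obtain ⟨h1, h2⟩ := key c i j k l hij
    exact h2 (eq_of_eisensteinEval_eq hm h1 h)
  eq_of_smul_sub_eq c d s t i j k l hcd h := by
    have key : ∀ (c d : Bool) (s t : ℤˣ) (i j k l : Fin 3), c ≠ d →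
        EisensteinSmall ((s : ℤ) • (eisensteinVec c i - eisensteinVec c j) -
          (t : ℤ) • (eisensteinVec d k - eisensteinVec d l)) ∧
        ((s : ℤ) • (eisensteinVec c i - eisensteinVec c j) =
          (t : ℤ) • (eisensteinVec d k - eisensteinVec d l) → i = j) := by
      decide +kernel
    simp only [eisensteinLabel, ← map_sub, ← map_zsmul] at h
    obtain ⟨h1, h2⟩ := key c d s t i j k l hcd
    exact h2 (eq_of_eisensteinEval_eq hm h1 h)
  eq_of_path_three c a b i j k hab h := by
    have key : ∀ c a b i j k, a ≠ b →
        EisensteinSmall (eisensteinVec c a - eisensteinVec c b + eisensteinVec c a -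
          (eisensteinVec c i - eisensteinVec c j + eisensteinVec c k)) ∧
        (eisensteinVec c a - eisensteinVec c b + eisensteinVec c a =
          eisensteinVec c i - eisensteinVec c j + eisensteinVec c k → i = a) := by
      decide +kernel
    simp only [eisensteinLabel, ← map_sub, ← map_add] at h
    obtain ⟨h1, h2⟩ := key c a b i j k hab
    exact h2 (eq_of_eisensteinEval_eq hm h1 h)

set_option synthInstance.maxSize 1000 in
set_option synthInstance.maxHeartbeats 400000 in
/-- The combination `3 γ₁ - 2 γ₀ - γ₂` vanishes for the powers of `2` modulo `7`, so its values for
the two kinds cancel. A choice of signs and of permutations of the labels preserves this relation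
only if the signs agree and both permutations are the same cyclic shift; of the latter, only the
case of a fixed label is recorded. -/
lemma eisensteinLabel_relation {m : ℕ} (hm : 100 ≤ m) {s t : ℤˣ} {π ρ : Fin 3 → Fin 3}
    (hπ : Function.Injective π) (hρ : Function.Injective ρ)
    (h : (s : ℤ) • (3 • eisensteinLabel m false (π 1) - 2 • eisensteinLabel m false (π 0) -
        eisensteinLabel m false (π 2)) +
      (t : ℤ) • (3 • eisensteinLabel m true (ρ 1) - 2 • eisensteinLabel m true (ρ 0) -
        eisensteinLabel m true (ρ 2)) = 0) :
    s = t ∧ (π 0 = 0 → ∀ i, π i = i ∧ ρ i = i) := by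
  have key : ∀ p₀ p₁ p₂ r₀ r₁ r₂ : Fin 3, p₀ ≠ p₁ → p₁ ≠ p₂ → p₂ ≠ p₀ → r₀ ≠ r₁ → r₁ ≠ r₂ →
      r₂ ≠ r₀ → ∀ s t : ℤˣ,
      EisensteinSmall ((s : ℤ) • (3 • eisensteinVec false p₁ - 2 • eisensteinVec false p₀ -
        eisensteinVec false p₂) +
        (t : ℤ) • (3 • eisensteinVec true r₁ - 2 • eisensteinVec true r₀ -
        eisensteinVec true r₂) - 0) ∧
      ((s : ℤ) • (3 • eisensteinVec false p₁ - 2 • eisensteinVec false p₀ -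
        eisensteinVec false p₂) +
        (t : ℤ) • (3 • eisensteinVec true r₁ - 2 • eisensteinVec true r₀ -
        eisensteinVec true r₂) = 0 →
        s = t ∧ (p₀ = 0 → (p₁ = 1 ∧ p₂ = 2) ∧ (r₀ = 0 ∧ r₁ = 1 ∧ r₂ = 2))) := by
    decide +kernel
  obtain ⟨h1, h2⟩ := key (π 0) (π 1) (π 2) (ρ 0) (ρ 1) (ρ 2) (hπ.ne (by decide))
    (hπ.ne (by decide)) (hπ.ne (by decide)) (hρ.ne (by decide)) (hρ.ne (by decide))
    (hρ.ne (by decide)) s t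
  rw [← map_zero (eisensteinEval m)] at h
  simp only [eisensteinLabel, ← map_sub, ← map_add, ← map_zsmul, ← map_nsmul] at h
  obtain ⟨h3, h4⟩ := h2 (eq_of_eisensteinEval_eq hm h1 h)
  refine ⟨h3, fun h0 i => ?_⟩
  obtain ⟨⟨h5, h6⟩, h7, h8, h9⟩ := h4 h0
  fin_cases i
  · exact ⟨h0, h7⟩
  · exact ⟨h5, h8⟩
  · exact ⟨h6, h9⟩

lemma eisenstein_natCast_sq (m : ℕ) :
    (m : ZMod (m ^ 2 + m + 1)) ^ 2 + m + 1 = 0 := by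
  exact_mod_cast ZMod.natCast_self (m ^ 2 + m + 1)

lemma eisensteinLabel_not (m : ℕ) (c : Bool) (i : Fin 3) :
    (AddEquiv.refl (ZMod 7)).prodCongr (AddEquiv.neg (ZMod (m ^ 2 + m + 1)))
      (eisensteinLabel m c i) = eisensteinLabel m (!c) i := by
  refine Prod.ext rfl ?_
  change -(eisensteinLabel m c i).2 = (eisensteinLabel m (!c) i).2
  cases c <;> simp [eisensteinLabel, eisensteinEval, eisensteinVec] <;> ring

/-- Multiplication by the cube root of unity `(2, m)` shifts the labels. -/
lemma exists_shift_eisensteinLabel (m : ℕ) :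
    ∃ φ : AddAut (ZMod 7 × ZMod (m ^ 2 + m + 1)),
      ∀ c i, φ (eisensteinLabel m c i) = eisensteinLabel m c (i + 1) := by
  have hm := eisenstein_natCast_sq m
  have h7 : (2 * 4 : ZMod 7) = 1 := by decide
  have hu : (m : ZMod (m ^ 2 + m + 1)) * (-1 - m) = 1 := by linear_combination -hm
  refine ⟨AddAut.mulLeft ⟨(2, (m : ZMod (m ^ 2 + m + 1))), (4, -1 - m),
    Prod.ext h7 hu, Prod.ext ((mul_comm _ _).trans h7) ((mul_comm _ _).trans hu)⟩, ?_⟩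
  intro c i
  refine Prod.ext ?_ ?_
  · change 2 * (![1, 2, 4] i : ZMod 7) = ![1, 2, 4] (i + 1)
    revert i; decide
  · change (m : ZMod (m ^ 2 + m + 1)) * (eisensteinLabel m c i).2 = (eisensteinLabel m c (i + 1)).2
    fin_cases i <;> cases c <;>
      simp [eisensteinLabel, eisensteinEval, eisensteinVec] <;>
      first | linear_combination hm | linear_combination -hm

lemma eisensteinLabel_isEdgeTransitive (m : ℕ) :
    (signedGraph (eisensteinLabel m)).IsEdgeTransitive := by
  refine signedGraph_isEdgeTransitive (fun i j => ?_) ⟨_, eisensteinLabel_not m⟩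
  obtain ⟨φ, hφ⟩ := exists_shift_eisensteinLabel m
  have hpow : ∀ d : Fin 3, ∃ ψ : AddAut (ZMod 7 × ZMod (m ^ 2 + m + 1)), ∀ c l,
      ψ (eisensteinLabel m c l) = eisensteinLabel m c (l + d) := by
    intro d
    fin_cases d
    · exact ⟨AddEquiv.refl _, fun c l => by simp⟩
    · exact ⟨φ, hφ⟩
    · refine ⟨φ.trans φ, fun c l => ?_⟩
      rw [AddEquiv.trans_apply, hφ, hφ, add_assoc l]
      rfl
  obtain ⟨ψ, hψ⟩ := hpow (j - i)
  exact ⟨ψ, Equiv.addRight (j - i), hψ, by simp⟩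

lemma eisensteinLabel_connected {m : ℕ} (h3 : 3 ∣ m) :
    (signedGraph (eisensteinLabel m)).Connected := by
  refine signedGraph_connected fun a => ?_
  set S := AddSubgroup.closure {d | ∃ c i j, d = eisensteinLabel m c i - eisensteinLabel m c j}
  have hS : ∀ c i j, eisensteinLabel m c i - eisensteinLabel m c j ∈ S := fun c i j =>
    AddSubgroup.subset_closure ⟨c, i, j, rfl⟩
  obtain ⟨r, hr⟩ := h3
  have hr' : (m : ZMod (m ^ 2 + m + 1)) = 3 * r := by exact_mod_cast congrArg Nat.cast hr
  -- the two kinds cancel in the second coordinate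
  have h10 : ((1, 0) : ZMod 7 × ZMod (m ^ 2 + m + 1)) ∈ S := by
    have h := S.nsmul_mem (S.add_mem (hS false 1 0) (hS true 1 0)) 4
    convert h using 1
    refine Prod.ext ?_ ?_
    · simp [eisensteinLabel, eisensteinEval, eisensteinVec]; decide
    · simp [eisensteinLabel, eisensteinEval, eisensteinVec]
  have h0m : ((0, m - 1) : ZMod 7 × ZMod (m ^ 2 + m + 1)) ∈ S := by
    have h := S.sub_mem (hS false 1 0) h10
    convert h using 1
    refine Prod.ext ?_ ?_
    · simp [eisensteinLabel, eisensteinEval, eisensteinVec]; decide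
    · simp [eisensteinLabel, eisensteinEval, eisensteinVec]
  have h03 : ((0, 3) : ZMod 7 × ZMod (m ^ 2 + m + 1)) ∈ S := by
    have h := S.neg_mem (S.add_mem (S.sub_mem (hS false 2 1) (S.nsmul_mem h10 2))
      (S.nsmul_mem h0m 2))
    convert h using 1
    refine Prod.ext ?_ ?_
    · simp [eisensteinLabel, eisensteinEval, eisensteinVec]; decide
    · simp [eisensteinLabel, eisensteinEval, eisensteinVec]; ring
  have h01 : ((0, 1) : ZMod 7 × ZMod (m ^ 2 + m + 1)) ∈ S := by
    have h := S.sub_mem (S.nsmul_mem h03 r) h0m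
    convert h using 1
    refine Prod.ext ?_ ?_
    · simp
    · simp [hr']; ring
  have h := S.add_mem (S.nsmul_mem h10 a.1.val) (S.nsmul_mem h01 a.2.val)
  convert h using 1
  refine Prod.ext ?_ ?_ <;> simp

/-- An automorphism that preserves the kind of an edge preserves each half of the graph, and it is
trivial if it fixes the base vertex and one of its neighbours. -/
lemma eisensteinLabel_rigid {m : ℕ} (hm : 100 ≤ m) (h3 : 3 ∣ m)
    (g : signedGraph (eisensteinLabel m) ≃g signedGraph (eisensteinLabel m)) {i' : Fin 3}
    (h : g (signedStep (eisensteinLabel m) false 0 (1, 0)) = signedStep (eisensteinLabel m) false i' (g (1, 0))) :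
    (g (1, 0)).1 false = (g (1, 0)).1 true ∧ (g (1, 0) = (1, 0) → i' = 0 → g = 1) := by
  have hγ := eisensteinLabel_isGeneric hm
  have hconn := eisensteinLabel_connected h3
  obtain ⟨π, hinj, hπ⟩ := hγ.exists_labelMap g (by decide) hconn h
  -- the closed walk with total displacement `3 γ₁ - 2 γ₀ - γ₂` of each kind
  let T : Bool → Fin 3 → Fin 3 → (Bool → ℤˣ) × (ZMod 7 × ZMod (m ^ 2 + m + 1)) →
      (Bool → ℤˣ) × (ZMod 7 × ZMod (m ^ 2 + m + 1)) := fun c i j x =>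
    signedStep (eisensteinLabel m) c j (signedStep (eisensteinLabel m) c i x)
  have hT : ∀ c i j x, T c i j x =
      (x.1, x.2 + (x.1 c : ℤ) • (eisensteinLabel m c i - eisensteinLabel m c j)) := fun c i j x =>
    signedStep_pair c i j x
  have hgT : ∀ c i j x, g (T c i j x) = T c (π c i) (π c j) (g x) := by
    intro c i j x
    simp only [T, hπ]
  have hclosed : T true 1 2 (T true 1 0 (T true 1 0 (T false 1 2 (T false 1 0
      (T false 1 0 (1, 0)))))) = (1, 0) := by
    simp only [hT]
    refine Prod.ext rfl (Prod.ext ?_ ?_)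
    · simp [eisensteinLabel, eisensteinEval, eisensteinVec]; decide
    · simp [eisensteinLabel, eisensteinEval, eisensteinVec]; ring
  have hg := congrArg g hclosed
  simp only [hgT] at hg
  simp only [hT] at hg
  have hg2 := congrArg Prod.snd hg
  simp only [add_assoc, add_eq_left] at hg2
  obtain ⟨h1, h2⟩ := eisensteinLabel_relation hm (s := (g (1, 0)).1 false)
    (t := (g (1, 0)).1 true) (hinj false) (hinj true) (by
      refine Eq.trans ?_ hg2
      module)
  refine ⟨h1, fun hx hi => ?_⟩
  have h0 : π false 0 = 0 := by
    rw [hi, hπ] at h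
    exact (signedStep_inj hγ.injective h).2
  refine IsGenericLabel.eq_one_of_labels_fixed g hconn hx fun y c i => ?_
  rw [hπ]
  cases c
  · rw [(h2 h0 i).1]
  · rw [(h2 h0 i).2]

theorem eisensteinLabel_isSemisymmetric {m : ℕ} (hm : 100 ≤ m) (h3 : 3 ∣ m) :
    (signedGraph (eisensteinLabel m)).IsSemisymmetric := by
  refine ⟨⟨_, signedGraph_hasValency (eisensteinLabel_isGeneric hm).injective⟩,
    eisensteinLabel_isEdgeTransitive m, fun hvt => ?_⟩
  obtain ⟨f, hf⟩ := hvt (1, 0) (Function.update (1 : Bool → ℤˣ) false (-1), 0)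
  obtain ⟨c, i, hi⟩ := f.map_adj_iff.mpr
    (signedGraph_adj_step (γ := eisensteinLabel m) false 0 (1, 0))
  cases c
  · have h := (eisensteinLabel_rigid hm h3 f hi).1
    rw [hf] at h
    exact absurd (show (-1 : ℤˣ) = 1 from h) (by decide)
  · -- if `f` interchanges the kinds, compose it with the swap of kinds
    let θ := signedSwap _ (eisensteinLabel_not m)
    have h := (eisensteinLabel_rigid hm h3 (θ * f) (i' := i) (by
      rw [RelIso.mul_apply, RelIso.mul_apply, hi]
      exact signedSwap_step _ _ true i _)).1
    rw [RelIso.mul_apply, hf, signedSwap_apply] at h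
    exact absurd (show (1 : ℤˣ) = -1 from h) (by decide)

theorem eisensteinLabel_isEdgeRegular {m : ℕ} (hm : 100 ≤ m) (h3 : 3 ∣ m) :
    (signedGraph (eisensteinLabel m)).IsEdgeRegular := by
  refine ⟨eisensteinLabel_isEdgeTransitive m, fun e f hf => ?_⟩
  obtain ⟨a, ha⟩ := eisensteinLabel_isEdgeTransitive m
    ⟨s((1, 0), signedStep (eisensteinLabel m) false 0 (1, 0)), signedGraph_adj_step false 0 _⟩ e
  have h : (a⁻¹ * f * a).mapEdgeSet
      ⟨s((1, 0), signedStep (eisensteinLabel m) false 0 (1, 0)), signedGraph_adj_step false 0 _⟩ =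
      ⟨s((1, 0), signedStep (eisensteinLabel m) false 0 (1, 0)), signedGraph_adj_step false 0 _⟩ := by
    have h1 : ∀ (x y : signedGraph (eisensteinLabel m) ≃g signedGraph (eisensteinLabel m)) e',
        (x * y).mapEdgeSet e' = x.mapEdgeSet (y.mapEdgeSet e') := by
      rintro x y ⟨e', he'⟩
      induction e' using Sym2.ind with
      | h u v => rfl
    rw [h1, h1, ha, hf]
    exact a.mapEdgeSet.injective (by
      rw [← h1, ha, mul_inv_cancel]
      obtain ⟨e, he⟩ := e
      induction e using Sym2.ind with
      | h u v => rfl)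
  have h1 : a⁻¹ * f * a = 1 := by
    generalize a⁻¹ * f * a = g at h
    have h2 : s(g (1, 0), g (signedStep (eisensteinLabel m) false 0 (1, 0))) =
        s((1, 0), signedStep (eisensteinLabel m) false 0 (1, 0)) := congrArg Subtype.val h
    rcases Sym2.eq_iff.mp h2 with ⟨h4, h5⟩ | ⟨h4, h5⟩
    · exact (eisensteinLabel_rigid hm h3 g (i' := 0) (by rw [h4, h5])).2 h4 rfl
    · have h6 := (eisensteinLabel_rigid hm h3 g (i' := 0) (by
        rw [h4, h5, signedStep_signedStep])).1
      rw [h4] at h6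
      exact absurd (show (-1 : ℤˣ) = 1 from h6) (by decide)
  rw [mul_eq_one_iff_eq_inv] at h1
  have h2 : f = a * (a⁻¹ * f) := by group
  rw [h2, h1, mul_inv_cancel]

lemma exists_isEdgeRegular_of_le_card (N : ℕ) :
    ∃ (V : Type) (_ : Finite V) (Γ : SimpleGraph V),
      N ≤ Nat.card V ∧ Γ.Connected ∧ Γ.IsBiDihedrant ∧ Γ.IsSemisymmetric ∧
        Γ.IsEdgeRegular ∧ Γ.HasValency 6 := by
  -- divisibility by `7` makes `m ^ 2 + m + 1` prime to `7`
  obtain ⟨m, hm, hN, h3, h7⟩ : ∃ m : ℕ, 100 ≤ m ∧ N ≤ m ∧ 3 ∣ m ∧ 7 ∣ m :=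
    ⟨21 * (N + 5), by omega, by omega, by omega, by omega⟩
  have hcop : Nat.Coprime 7 (m ^ 2 + m + 1) := by
    rw [Nat.Prime.coprime_iff_not_dvd (by norm_num)]
    intro h
    have h1 : 7 ∣ m ^ 2 + m := dvd_add (dvd_pow h7 two_ne_zero) h7
    have := (Nat.dvd_add_right h1).mp h
    omega
  refine ⟨_, inferInstance, signedGraph (eisensteinLabel m), ?_, eisensteinLabel_connected h3,
    signedGraph_isBiDihedrant ?_ (ZMod.chineseRemainder hcop).toAddEquiv,
    eisensteinLabel_isSemisymmetric hm h3, eisensteinLabel_isEdgeRegular hm h3, ?_⟩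
  · rw [Nat.card_prod, Nat.card_prod, Nat.card_zmod, Nat.card_zmod]
    have : 0 < Nat.card (Bool → ℤˣ) := Nat.card_pos
    nlinarith [Nat.zero_le (m ^ 2)]
  · nlinarith [Nat.zero_le (m ^ 2)]
  · simpa using signedGraph_hasValency (eisensteinLabel_isGeneric hm).injective

end ValencySix

end SimpleGraph

theorem theorem1p5 :
    -- a connected semisymmetric bi-dihedrant has valency at least 6
    (∀ (V : Type*) [Finite V] (Γ : SimpleGraph V),
      Γ.Connected → Γ.IsBiDihedrant → Γ.IsSemisymmetric → ∀ d : ℕ, Γ.HasValency d → 6 ≤ d) ∧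
    -- there is a connected semisymmetric bi-dihedrant of valency 2k for each odd k ≥ 3
    (∀ k : ℕ, Odd k → 3 ≤ k →
      ∃ (V : Type) (_ : Finite V) (Γ : SimpleGraph V),
        Γ.Connected ∧ Γ.IsBiDihedrant ∧ Γ.IsSemisymmetric ∧ Γ.HasValency (2 * k)) ∧
    -- there are arbitrarily large (so infinitely many) edge-regular ones of valency 6
    (∀ N : ℕ, ∃ (V : Type) (_ : Finite V) (Γ : SimpleGraph V),
        N ≤ Nat.card V ∧ Γ.Connected ∧ Γ.IsBiDihedrant ∧ Γ.IsSemisymmetric ∧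
          Γ.IsEdgeRegular ∧ Γ.HasValency 6) := by
  exact ⟨fun V _ Γ hconn hbd hss d hd =>
      SimpleGraph.six_le_valency_of_isSemisymmetric hconn hbd hss hd,
    fun k hk h3 => SimpleGraph.exists_semisymmetric_of_odd hk h3,
    SimpleGraph.exists_isEdgeRegular_of_le_card⟩
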